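/- Let $B$ be a band, i.e. a semigroup of idempotents, written as a semilattice $Y$ of rectangular bands, $B=\bigcup_{\alpha\in Y}B_\alpha$ (so $x\in B_\alpha$, $y\in B_\beta$ satisfy $\alpha\le\beta$ iff $BxB\subseteq ByB$). Let $$\mathrm{IG}(B)=\langle\, \overline{B} : \bar e\,\bar f=\overline{ef},\ e,f\in B,\ \{e,f\}\cap\{ef,fe\}\neq\emptyset\,\rangle ,\qquad \overline B=\{\bar e: e\in B\},$$ be the free idempotent generated semigroup over $B$. *Definitions.* For a semigroup $S$, $a\,\mathcal R^*\,b$ means that $xa=ya\Leftrightarrow xb=yb$ for all $x,y\in S^1$, and $a\,\mathcal L^*\,b$ is defined dually; $S$ is *abundant* if every $\mathcal R^*$-class and every $\mathcal L^*$-class contains an idempotent. $\mathcal R$ and $\mathcal L$ denote Green's relations on $B$. The band $B$ is *normal* if it satisfies $xyzx=xzyx$, and *locally large* if $uv=vu=u$ whenever $u\in B_\alpha$, $v\in B_\beta$ and $\alpha<\beta$. For a nonempty word $w=\bar x_1\cdots\bar x_n$ with $x_p\in B_{\alpha_p}$, the *left to right significant indices* $i_1<\dots<i_r$ are defined as follows: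 put $k_0=0$; given $k_{s-1}<n$, let $i_s$ be the largest $p$ with $k_{s-1}<p\le n$ such that $\alpha_{k_{s-1}+1},\dots,\alpha_{p}\ge\alpha_{p}$, and let $k_s$ be the largest $m$ with $i_s\le m\le n$ such that $\alpha_{i_s},\dots,\alpha_{m}\ge\alpha_{i_s}$; stop when $k_r=n$. The number $r$ is the *$Y$-length* of $w$. The word $w$ is in *almost normal form* if it splits into $r\ge1$ consecutive nonempty blocks such that all letters of the $s$-th block lie in one component $B_{\beta_s}$, and $\beta_s,\beta_{s+1}$ are incomparable for $1\le s<r$. $\mathrm{IG}(B)$ satisfies *Condition (P)* if, for any two almost normal forms with $\bar u_1\cdots\bar u_n=\bar v_1\cdots\bar v_m$ in $\mathrm{IG}(B)$, of $Y$-length $r$ and with left to right significant indices $i_1,\dots,i_r=n$ and $l_1,\dots,l_r=m$ respectively (and $i_0=l_0=0$): (i) for all $s\in[1,r]$, $u_{i_s}\,\mathcal L\,v_{l_s}$ implies $\bar u_1\cdots\bar u_{i_s}=\bar v_1\cdots\bar v_{l_s}$ in $\mathrm{IG}(B)$; (ii) for all $t\in[0,r-1]$, $u_{i_t+1}\,\mathcal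 R\,v_{l_t+1}$ implies $\bar u_{i_t+1}\cdots\bar u_n=\bar v_{l_t+1}\cdots\bar v_m$ in $\mathrm{IG}(B)$. **Proposition.** (a) Suppose that $\mathrm{IG}(B)$ satisfies Condition (P) and that $B$ is normal or locally large. Then $\mathrm{IG}(B)$ is abundant. Moreover, for every word $\bar x_1\cdots\bar x_n$ in almost normal form, $\bar x_1\cdots\bar x_n\ \mathcal R^*\ \bar x_1$ and $\bar x_1\cdots\bar x_n\ \mathcal L^*\ \bar x_n$ in $\mathrm{IG}(B)$. (b) If $B$ is locally large, then $\mathrm{IG}(B)$ satisfies Condition (P). (c) Consequently, $\mathrm{IG}(B)$ is abundant for every locally large band $B$. -/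

import Mathlib

namespace FreeIG

/-- A band: a semigroup in which every element is idempotent. -/
class Band (B : Type*) extends Semigroup B where
  mul_self : ∀ x : B, x * x = x

section Semigroups

variable {S : Type*} [Semigroup S]

/-- Green's relation `𝓛`: `S¹a = S¹b`. Adjoining a new identity to a semigroup that already has one
does not change this relation. -/
def GreenL (a b : S) : Prop :=
  (Set.range fun x : WithOne S => x * (a : WithOne S)) =
    Set.range fun x : WithOne S => x * (b : WithOne S)

/-- Green's relation `𝓡`: `aS¹ = bS¹`. -/
def GreenR (a b : S) : Prop :=
  (Set.range fun x : WithOne S => (a : WithOne S) * x) =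
    Set.range fun x : WithOne S => (b : WithOne S) * x

/-- The relation `𝓛*`: for all `x, y ∈ S¹`, `ax = ay ↔ bx = by`. Adjoining a new identity to a
semigroup that already has one does not change this relation. -/
def LStar (a b : S) : Prop :=
  ∀ x y : WithOne S, (a : WithOne S) * x = a * y ↔ (b : WithOne S) * x = b * y

/-- The relation `𝓡*`: for all `x, y ∈ S¹`, `xa = ya ↔ xb = yb`. -/
def RStar (a b : S) : Prop :=
  ∀ x y : WithOne S, x * (a : WithOne S) = y * a ↔ x * (b : WithOne S) = y * b

variable (S) in
/-- A semigroup is abundant if every `𝓛*`-class and every `𝓡*`-class contains an idempotent. -/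
def IsAbundant : Prop :=
  ∀ a : S, (∃ e : S, IsIdempotentElem e ∧ LStar a e) ∧ (∃ e : S, IsIdempotentElem e ∧ RStar a e)

end Semigroups

section Presentation

variable (B : Type*) [Band B]

/-- The defining relations `ē f̄ = \overline{ef}`, one for each basic pair `(e, f)`, that is, each
pair with `{e, f} ∩ {ef, fe} ≠ ∅`. -/
inductive BasicRel : FreeSemigroup B → FreeSemigroup B → Prop
  | basic (e f : B) (h : (({e, f} : Set B) ∩ {e * f, f * e}).Nonempty) :
      BasicRel (FreeSemigroup.of e * FreeSemigroup.of f) (FreeSemigroup.of (e * f))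

/-- The free idempotent generated semigroup `IG(B)` over the band `B`. -/
def IG : Type _ := (conGen (BasicRel B)).Quotient

instance : Semigroup (IG B) := inferInstanceAs (Semigroup (conGen (BasicRel B)).Quotient)

variable {B}

/-- The element of `IG(B)` represented by a word of `B⁺`. -/
def IG.mk (w : FreeSemigroup B) : IG B := ((w : (conGen (BasicRel B)).Quotient))

/-- The generator `x̄` of `IG(B)`. -/
def IG.bar (x : B) : IG B := IG.mk (FreeSemigroup.of x)

end Presentation

section Components

variable {B : Type*} [Band B]

/-- The component of `x` in the structure semilattice `Y` of the band `B`. The semilattice `Y` is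
realised as the set of principal ideals `BxB`, ordered by inclusion and with meet the intersection,
and `B_α = {x | comp x = α}`; by the two lemmas below `comp` is a morphism onto `Y` and the `B_α`
are rectangular bands. -/
def comp (x : B) : Set B := {z | ∃ a b : B, z = a * x * b}

theorem comp_mul (x y : B) : comp (x * y) = comp x ∩ comp y := by
  ext z
  constructor
  · rintro ⟨a, b, rfl⟩
    exact ⟨⟨a, y * b, by simp only [mul_assoc]⟩, ⟨a * x, b, by simp only [mul_assoc]⟩⟩
  · rintro ⟨⟨a, b, h1⟩, ⟨c, d, h2⟩⟩
    refine ⟨c * (y * (d * a)), d * a * x * b, ?_⟩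
    have e : y * (d * a) * x = y * (d * a) * (x * y) * (d * a * x) := by
      calc y * (d * a) * x = (y * (d * a) * x) * (y * (d * a) * x) := by rw [Band.mul_self]
        _ = _ := by simp only [mul_assoc]
    calc z = (c * y * d) * (a * x * b) := by rw [← h1, ← h2, Band.mul_self]
      _ = c * (y * (d * a) * x) * b := by simp only [mul_assoc]
      _ = c * (y * (d * a) * (x * y) * (d * a * x)) * b := by rw [← e]
      _ = _ := by simp only [mul_assoc]

theorem comp_eq_iff (x y : B) : comp x = comp y ↔ x * y * x = x ∧ y * x * y = y := by
  have key : ∀ s y : B, s ∈ comp y → s * y * s = s := by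
    rintro s y ⟨a, b, hs⟩
    have h1 : s * y * b = s := by
      calc s * y * b = a * ((y * b) * (y * b)) := by rw [hs]; simp only [mul_assoc]
        _ = s := by rw [Band.mul_self, hs, mul_assoc]
    calc s * y * s = s * y * (s * y * b) := by rw [h1]
      _ = (s * y) * (s * y) * b := by simp only [mul_assoc]
      _ = s := by rw [Band.mul_self, h1]
  have self : ∀ s : B, s ∈ comp s := fun s => ⟨s, s, by simp only [Band.mul_self]⟩
  have tr : ∀ s t : B, s * t * s = s → comp s ⊆ comp t := by
    rintro s t h z ⟨a, b, rfl⟩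
    exact ⟨a * s, s * b, by nth_rw 1 [← h]; simp only [mul_assoc]⟩
  constructor
  · intro h
    exact ⟨key x y (h ▸ self x), key y x (h ▸ self y)⟩
  · rintro ⟨h1, h2⟩
    exact Set.Subset.antisymm (tr x y h1) (tr y x h2)

variable (B) in
/-- A normal band: `xyzx = xzyx` holds identically. -/
def IsNormalBand : Prop := ∀ x y z : B, x * y * z * x = x * z * y * x

variable (B) in
/-- A locally large band: `uv = vu = u` whenever `u ∈ B_α`, `v ∈ B_β` and `α < β`. -/
def IsLocallyLarge : Prop := ∀ u v : B, comp u < comp v → u * v = u ∧ v * u = u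

end Components

section Words

variable {B : Type*} [Band B]

/-- The letter `x_p` of the word `x_1 ⋯ x_n`, for `1 ≤ p ≤ n`. -/
def letter (w : FreeSemigroup B) (p : ℕ) : B := (w.head :: w.tail).getD (p - 1) w.head

/-- The subword `x_a ⋯ x_b` of the word `x_1 ⋯ x_n`, for `1 ≤ a ≤ b ≤ n`. -/
def subword (w : FreeSemigroup B) (a b : ℕ) : FreeSemigroup B :=
  ⟨letter w a, (List.range' (a + 1) (b - a)).map (letter w)⟩

/-- `i 1 < ⋯ < i r` are the left to right significant indices of the word `w = x_1 ⋯ x_n` (so its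
`Y`-length is `r`), with the convention `i 0 = 0`. With `x_p ∈ B_{α_p}` and `k 0 = 0`:
`i (s+1)` is the largest `p` such that `α_{k s + 1}, …, α_p ≥ α_p`, and then
`k (s+1)` is the largest `m` such that `α_{i (s+1)}, …, α_m ≥ α_{i (s+1)}`, until `k r = n`. -/
def IsSignificant (w : FreeSemigroup B) (r : ℕ) (i : ℕ → ℕ) : Prop :=
  i 0 = 0 ∧ ∃ k : ℕ → ℕ, k 0 = 0 ∧ k r = w.length ∧ ∀ s < r,
    IsGreatest {p | k s < p ∧ p ≤ w.length ∧
      ∀ q, k s < q → q ≤ p → comp (letter w p) ≤ comp (letter w q)} (i (s + 1)) ∧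
    IsGreatest {m | i (s + 1) ≤ m ∧ m ≤ w.length ∧
      ∀ q, i (s + 1) ≤ q → q ≤ m → comp (letter w (i (s + 1))) ≤ comp (letter w q)} (k (s + 1))

/-- `w = x_1 ⋯ x_n` is in almost normal form: there are `0 = i 0 < i 1 < ⋯ < i r = n` such that, for
each `s < r`, the letters `x_{i s + 1}, …, x_{i (s+1)}` all lie in the component `B_{α s}`, and
`α s`, `α (s+1)` are incomparable whenever `s + 1 < r`. -/
def IsAlmostNormal (w : FreeSemigroup B) : Prop :=
  ∃ (r : ℕ) (i : ℕ → ℕ) (α : ℕ → Set B), i 0 = 0 ∧ i r = w.length ∧ (∀ s < r, i s < i (s + 1)) ∧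
    (∀ s < r, ∀ p, i s < p → p ≤ i (s + 1) → comp (letter w p) = α s) ∧
    ∀ s, s + 1 < r → ¬ α s ≤ α (s + 1) ∧ ¬ α (s + 1) ≤ α s

variable (B) in
/-- Condition (P) for `IG(B)`. -/
def ConditionP : Prop :=
  ∀ u v : FreeSemigroup B, IsAlmostNormal u → IsAlmostNormal v → IG.mk u = IG.mk v →
    ∀ (r : ℕ) (i l : ℕ → ℕ), IsSignificant u r i → IsSignificant v r l →
      (∀ s, 1 ≤ s → s ≤ r → GreenL (letter u (i s)) (letter v (l s)) →
        IG.mk (subword u 1 (i s)) = IG.mk (subword v 1 (l s))) ∧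
      (∀ t < r, GreenR (letter u (i t + 1)) (letter v (l t + 1)) →
        IG.mk (subword u (i t + 1) u.length) = IG.mk (subword v (l t + 1) v.length))

end Words

end FreeIG

open FreeIG

/-!
Read a word from left to right with a stack whose entries are pairs (level, weight): a letter pops
the strictly higher levels on top of the stack, is absorbed by a strictly lower level, multiplies
the weight at its own level, and otherwise starts a new entry. For suitable weights the stack is an
invariant of the element of `IG(B)¹`, its entries correspond to the blocks of an almost normal form,
and reading an almost normal form `x w` loses no information about the stack left after reading `x`.

If `B` is locally large, then `x ↦ x̄` itself is a suitable weight, so the element of `IG(B)¹` can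
be recovered from its stack; this gives both Condition (P) and the cancellation behind `x̄ w 𝓡* x̄`.
If `B` is normal, trivial weights still show that, when `p x w = q x w`, almost normal forms of
`p x` and `q x` end in the same component. By normality both then absorb the same element
`x a x = x b x`, so they may be assumed to end in the same letter, and Condition (P) cancels the
rest. The statements on `𝓛*` follow by passing to the opposite band.
-/

namespace FreeIG

/-! ### A stack machine on words over a partially ordered alphabet -/

section Push

variable {Y N : Type*} [PartialOrder Y]

section Mul

variable [Mul N] {a c d : Y} {m n n' : N} {s t : List (Y × N)}

open Classical in
/-- The stack obtained from `s` by reading a letter of level `c` and weight `n`: strictly higher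
levels on top of the stack are popped, a strictly lower level absorbs the letter, an equal level
multiplies the weights, and an incomparable level is covered by a new entry. The top of the stack
is the head of the list. -/
noncomputable def push (c : Y) (n : N) : List (Y × N) → List (Y × N)
  | [] => [(c, n)]
  | (a, m) :: s =>
    if c < a then push c n s
    else if a < c then (a, m) :: s
    else if a = c then (a, m * n) :: s
    else (c, n) :: (a, m) :: s

@[simp] theorem push_nil : push c n [] = [(c, n)] := rfl

theorem push_of_lt (h : c < a) : push c n ((a, m) :: s) = push c n s := by
  simp [push, h]

theorem push_of_gt (h : a < c) : push c n ((a, m) :: s) = (a, m) :: s := by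
  simp [push, h, h.not_gt]

theorem push_of_eq (h : a = c) : push c n ((a, m) :: s) = (a, m * n) :: s := by
  simp [push, h]

theorem push_of_incompRel (h : IncompRel (· ≤ ·) a c) :
    push c n ((a, m) :: s) = (c, n) :: (a, m) :: s := by
  simp [push, h.not_lt, h.not_gt, h.ne]

theorem push_append (h : ¬ c < a) :
    push c n ((a, m) :: s ++ t) = push c n ((a, m) :: s) ++ t := by
  rcases lt_or_eq_or_gt_or_incompRel a c with hac | hac | hac | hac
  · simp only [List.cons_append, push_of_gt hac]
  · simp only [List.cons_append, push_of_eq hac]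
  · exact absurd hac h
  · simp only [List.cons_append, push_of_incompRel hac]

theorem exists_push_eq_cons (c : Y) (n : N) (s : List (Y × N)) :
    ∃ a m t, push c n s = (a, m) :: t ∧ a ≤ c := by
  induction s with
  | nil => exact ⟨c, n, [], rfl, le_rfl⟩
  | cons p s ih =>
    obtain ⟨a, m⟩ := p
    rcases lt_or_eq_or_gt_or_incompRel a c with h | h | h | h
    · exact ⟨a, m, s, push_of_gt h, h.le⟩
    · exact ⟨a, m * n, s, push_of_eq h, h.le⟩
    · rwa [push_of_lt h]
    · exact ⟨c, n, (a, m) :: s, push_of_incompRel h, le_rfl⟩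

theorem le_of_push_eq_self (h : push c n ((a, m) :: s) = (a, m) :: s) : a ≤ c := by
  obtain ⟨b, k, t, hpush, hb⟩ := exists_push_eq_cons c n ((a, m) :: s)
  have hab : (a, m) = (b, k) := (List.cons.inj (h.symm.trans hpush)).1
  exact (congrArg Prod.fst hab).trans_le hb

theorem push_push_of_lt (h : c < d) : push d n' (push c n s) = push c n s := by
  obtain ⟨a, m, t, hpush, ha⟩ := exists_push_eq_cons c n s
  rw [hpush, push_of_gt (ha.trans_lt h)]

theorem push_push_of_gt (h : d < c) : push d n' (push c n s) = push d n' s := by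
  induction s with
  | nil => rw [push_nil, push_of_lt h, push_nil]
  | cons p s ih =>
    obtain ⟨a, m⟩ := p
    rcases lt_or_eq_or_gt_or_incompRel a c with hac | hac | hac | hac
    · rw [push_of_gt hac]
    · rw [push_of_eq hac, push_of_lt (hac ▸ h), push_of_lt (hac ▸ h)]
    · rw [push_of_lt hac, push_of_lt (h.trans hac), ih]
    · rw [push_of_incompRel hac, push_of_lt h]

theorem push_eq_self_or_eq_cons (hcd : IncompRel (· ≤ ·) c d) (hs : push c n s = s) :
    push d n' s = s ∨ push d n' s = (d, n') :: s := by
  obtain _ | ⟨⟨a, m⟩, s⟩ := s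
  · exact Or.inr rfl
  have hac : a ≤ c := le_of_push_eq_self hs
  rcases lt_or_eq_or_gt_or_incompRel a d with had | had | had | had
  · exact Or.inl (push_of_gt had)
  · exact absurd (had ▸ hac) hcd.not_ge
  · exact absurd (had.le.trans hac) hcd.not_ge
  · exact Or.inr (push_of_incompRel had)

theorem eq_of_push_eq_of_incompRel (hcd : IncompRel (· ≤ ·) c d) (hs : push c n s = s)
    (ht : push c n t = t) (h : push d n' s = push d n' t) : s = t := by
  have not_cons : ∀ {s t : List (Y × N)}, push c n s = s → s ≠ (d, n') :: t := by
    rintro _ t hs rfl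
    exact hcd.not_ge (le_of_push_eq_self hs)
  rcases push_eq_self_or_eq_cons (n' := n') hcd hs with hds | hds <;>
    rcases push_eq_self_or_eq_cons (n' := n') hcd ht with hdt | hdt <;> rw [hds, hdt] at h
  · exact h
  · exact absurd h (not_cons hs)
  · exact absurd h.symm (not_cons ht)
  · exact (List.cons.inj h).2

end Mul

section Semigroup

variable [Semigroup N] {c : Y} {m n k : N} {s t : List (Y × N)}

theorem push_push_same : push c n (push c m s) = push c (m * n) s := by
  induction s with
  | nil => exact push_of_eq rfl
  | cons p s ih =>
    obtain ⟨a, l⟩ := p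
    rcases lt_or_eq_or_gt_or_incompRel a c with h | h | h | h
    · rw [push_of_gt h, push_of_gt h, push_of_gt h]
    · rw [push_of_eq h, push_of_eq h, push_of_eq h, mul_assoc]
    · rw [push_of_lt h, push_of_lt h, ih]
    · rw [push_of_incompRel h, push_of_incompRel h, push_of_eq rfl]

theorem eq_of_push_eq_of_mul_mul_eq (hk : m * n * k = m) (hs : push c m s = s)
    (ht : push c m t = t) (h : push c n s = push c n t) : s = t := by
  have undo : ∀ {s : List (Y × N)}, push c m s = s → push c k (push c n s) = s := by
    intro s hs
    nth_rw 1 [← hs]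
    rw [push_push_same, push_push_same, ← mul_assoc, hk, hs]
  rw [← undo hs, h, undo ht]

end Semigroup

end Push

section StackProd

variable {Y M : Type*} [Monoid M]

/-- The product of the weights in a stack, from bottom to top. -/
def stackProd (s : List (Y × M)) : M := (s.map Prod.snd).reverse.prod

@[simp] theorem stackProd_nil : stackProd ([] : List (Y × M)) = 1 := rfl

@[simp] theorem stackProd_cons (p : Y × M) (s : List (Y × M)) :
    stackProd (p :: s) = stackProd s * p.2 := by
  simp [stackProd]

end StackProd

section Run

theorem isChain_concat_concat {α : Type*} {R : α → α → Prop} {w : List α} {x y : α} :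
    List.IsChain R (w ++ [x] ++ [y]) ↔ List.IsChain R (w ++ [x]) ∧ R x y := by
  simp

variable {B Y N : Type*} [PartialOrder Y] (c : B → Y)

/-- Two letters whose levels are equal or incomparable, as are any two neighbours in an almost
normal form. -/
def Adj (x y : B) : Prop := c x = c y ∨ IncompRel (· ≤ ·) (c x) (c y)

variable {c}

theorem Adj.symm {x y : B} (h : Adj c x y) : Adj c y x :=
  h.imp Eq.symm IncompRel.symm

theorem Adj.not_lt {x y : B} (h : Adj c x y) : ¬ c y < c x :=
  h.elim (fun heq => heq.not_gt) (fun hinc => hinc.not_gt)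

section Mul

variable [Mul N] (c) (π : B → N)

/-- The stack obtained from `s` by reading the word `w` from left to right, where the letter `x`
has level `c x` and weight `π x`. -/
noncomputable def run (s : List (Y × N)) (w : List B) : List (Y × N) :=
  w.foldl (fun s x => push (c x) (π x) s) s

@[simp] theorem run_nil (s : List (Y × N)) : run c π s [] = s := rfl

@[simp] theorem run_cons (s : List (Y × N)) (x : B) (w : List B) :
    run c π s (x :: w) = run c π (push (c x) (π x) s) w := rfl

theorem run_append (s : List (Y × N)) (u v : List B) :
    run c π s (u ++ v) = run c π (run c π s u) v := List.foldl_append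

theorem run_concat (s : List (Y × N)) (u : List B) (x : B) :
    run c π s (u ++ [x]) = push (c x) (π x) (run c π s u) := run_append c π s u [x]

variable {c}

theorem exists_run_concat_eq_cons {u : List B} {x : B} (h : List.IsChain (Adj c) (u ++ [x])) :
    ∃ m s, run c π [] (u ++ [x]) = (c x, m) :: s := by
  induction u using List.reverseRecOn generalizing x with
  | nil => exact ⟨π x, [], rfl⟩
  | append_singleton u y ih =>
    obtain ⟨hu, hyx⟩ : List.IsChain (Adj c) (u ++ [y]) ∧ Adj c y x :=
      isChain_concat_concat.1 h
    obtain ⟨m, s, hrun⟩ := ih hu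
    rw [run_concat, hrun]
    rcases hyx with heq | hinc
    · exact ⟨m * π x, s, by rw [push_of_eq heq, heq]⟩
    · exact ⟨π x, _, push_of_incompRel hinc⟩

theorem level_eq_of_run_concat_eq {π : B → N} {u v : List B} {x y : B}
    (hu : List.IsChain (Adj c) (u ++ [x])) (hv : List.IsChain (Adj c) (v ++ [y]))
    (h : run c π [] (u ++ [x]) = run c π [] (v ++ [y])) : c x = c y := by
  obtain ⟨_, _, hx⟩ := exists_run_concat_eq_cons π hu
  obtain ⟨_, _, hy⟩ := exists_run_concat_eq_cons π hv
  exact congrArg Prod.fst (List.cons.inj (hx.symm.trans (h.trans hy))).1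

theorem run_eq_run_nil_append {s : List (Y × N)} {w : List B} (hw : List.IsChain (Adj c) w)
    (hs : ∀ p ∈ s.head?, ∀ x ∈ w.head?, IncompRel (· ≤ ·) p.1 (c x)) :
    run c π s w = run c π [] w ++ s := by
  induction w using List.reverseRecOn with
  | nil => rfl
  | append_singleton w y ih =>
    rcases List.eq_nil_or_concat' w with rfl | ⟨w, z, rfl⟩
    · obtain _ | ⟨⟨a, m⟩, s⟩ := s
      · rfl
      · exact push_of_incompRel (by simpa using hs)
    obtain ⟨hwz, hzy⟩ : List.IsChain (Adj c) (w ++ [z]) ∧ Adj c z y :=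
      isChain_concat_concat.1 hw
    obtain ⟨m, t, hrun⟩ := exists_run_concat_eq_cons π hwz
    rw [run_concat, run_concat c π [], ih hwz (by simpa [List.head?_append] using hs), hrun,
      push_append hzy.not_lt]

theorem run_append_of_incompRel {u v : List B} (hu : List.IsChain (Adj c) u)
    (hv : List.IsChain (Adj c) v)
    (huv : ∀ x ∈ u.getLast?, ∀ y ∈ v.head?, IncompRel (· ≤ ·) (c x) (c y)) :
    run c π [] (u ++ v) = run c π [] v ++ run c π [] u := by
  rw [run_append]
  refine run_eq_run_nil_append π hv ?_
  rcases List.eq_nil_or_concat' u with rfl | ⟨u, x, rfl⟩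
  · simp
  · obtain ⟨m, s, hrun⟩ := exists_run_concat_eq_cons π hu
    simpa [hrun] using huv

theorem length_run_of_forall_eq {w : List B} {a : Y} (hw : w ≠ []) (ha : ∀ x ∈ w, c x = a) :
    (run c π [] w).length = 1 := by
  have absorb : ∀ (v : List B) (m : N), (∀ x ∈ v, c x = a) →
      (run c π [(a, m)] v).length = 1 := by
    intro v
    induction v with
    | nil => simp
    | cons x v ih =>
      intro m hv
      rw [List.forall_mem_cons] at hv
      rw [run_cons, push_of_eq hv.1.symm]
      exact ih _ hv.2
  obtain ⟨x, w, rfl⟩ := List.exists_cons_of_ne_nil hw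
  rw [List.forall_mem_cons] at ha
  rw [run_cons, push_nil, ha.1]
  exact absorb w _ ha.2

end Mul

section Semigroup

variable [Semigroup N] {π : B → N}

theorem eq_of_run_eq (idem : ∀ x, π x * π x = π x)
    (inv : ∀ x y, c x = c y → ∃ t, π x * π y * t = π x) {x : B} {w : List B}
    {s t : List (Y × N)} (hw : List.IsChain (Adj c) (x :: w)) (hs : push (c x) (π x) s = s)
    (ht : push (c x) (π x) t = t) (h : run c π s w = run c π t w) : s = t := by
  induction w generalizing x s t with
  | nil => exact h
  | cons y w ih =>
    rw [List.isChain_cons_cons] at hw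
    have push_idem : ∀ s, push (c y) (π y) (push (c y) (π y) s) = push (c y) (π y) s :=
      fun s => by rw [push_push_same, idem]
    have hpush : push (c y) (π y) s = push (c y) (π y) t :=
      ih hw.2 (push_idem s) (push_idem t) h
    rcases hw.1 with hxy | hxy
    · obtain ⟨k, hk⟩ := inv x y hxy
      exact eq_of_push_eq_of_mul_mul_eq hk hs ht (hxy ▸ hpush)
    · exact eq_of_push_eq_of_incompRel hxy hs ht hpush

theorem run_concat_eq_of_run_append_cons_eq (idem : ∀ x, π x * π x = π x)
    (inv : ∀ x y, c x = c y → ∃ t, π x * π y * t = π x) {x : B} {w : List B}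
    {s t : List (Y × N)} {p q : List B} (hw : List.IsChain (Adj c) (x :: w))
    (h : run c π s (p ++ x :: w) = run c π t (q ++ x :: w)) :
    run c π s (p ++ [x]) = run c π t (q ++ [x]) := by
  rw [List.append_cons p, List.append_cons q, run_append c π s, run_append c π t] at h
  refine eq_of_run_eq idem inv hw ?_ ?_ h <;> rw [run_concat, push_push_same, idem]

end Semigroup

section Monoid

variable {M : Type*} [Monoid M]

theorem stackProd_run {f : B → M} {w : List B} (hw : List.IsChain (Adj c) w) :
    stackProd (run c f [] w) = (w.map f).prod := by
  induction w using List.reverseRecOn with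
  | nil => rfl
  | append_singleton w y ih =>
    rcases List.eq_nil_or_concat' w with rfl | ⟨w, z, rfl⟩
    · simp
    obtain ⟨hwz, hzy⟩ : List.IsChain (Adj c) (w ++ [z]) ∧ Adj c z y :=
      isChain_concat_concat.1 hw
    obtain ⟨m, s, hrun⟩ := exists_run_concat_eq_cons f hwz
    rw [List.map_append, List.prod_append, ← ih hwz, run_concat, hrun]
    rcases hzy with heq | hinc
    · simp [push_of_eq heq, mul_assoc]
    · simp [push_of_incompRel hinc]

end Monoid

end Run

/-! ### Bands and the universal property of `IG B` -/

section Band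

variable {B : Type*} [Band B] {e f x y a : B}

theorem comp_mul_of_le (h : comp x ≤ comp y) : comp (x * y) = comp x := by
  rw [comp_mul]
  exact Set.inter_eq_left.2 h

theorem comp_mul_of_ge (h : comp y ≤ comp x) : comp (x * y) = comp y := by
  rw [comp_mul]
  exact Set.inter_eq_right.2 h

theorem mul_mul_of_comp_le (h : comp a ≤ comp x) : a * x * a = a := by
  have := ((comp_eq_iff a (a * x)).1 (comp_mul_of_le h).symm).1
  rwa [← mul_assoc, Band.mul_self] at this

theorem comp_sandwich (h : comp a ≤ comp x) : comp (x * a * x) = comp a := by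
  rw [comp_mul_of_le] <;> rw [comp_mul_of_ge h]
  exact h

theorem IsNormalBand.sandwich_eq (hB : IsNormalBand B) (h : comp x = comp y) :
    a * x * a = a * y * a := by
  have insert_left : ∀ {x y : B}, comp x = comp y → a * x * a = a * y * x * a := by
    intro x y hxy
    calc a * x * a = a * x * (y * x) * a := by
          rw [mul_assoc a x (y * x), ← mul_assoc x y, mul_mul_of_comp_le hxy.le]
      _ = a * (y * x) * x * a := hB a x (y * x)
      _ = a * y * x * a := by rw [mul_assoc a, mul_assoc y, Band.mul_self, ← mul_assoc a]
  calc a * x * a = a * y * x * a := insert_left h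
    _ = a * x * y * a := hB a y x
    _ = a * y * a := (insert_left h.symm).symm

/-- Basic pairs, written out as a disjunction. -/
def IsBasic (e f : B) : Prop := e * f = e ∨ e * f = f ∨ f * e = e ∨ f * e = f

theorem isBasic_iff_nonempty :
    IsBasic e f ↔ (({e, f} : Set B) ∩ {e * f, f * e}).Nonempty := by
  simp only [Set.Nonempty, Set.mem_inter_iff, Set.mem_insert_iff,
    Set.mem_singleton_iff, or_and_right, exists_or, exists_eq_left]
  simp only [IsBasic, @eq_comm B (_ * _)]
  tauto

theorem IsBasic.comp_le_or_le (h : IsBasic e f) : comp e ≤ comp f ∨ comp f ≤ comp e := by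
  have left : comp (e * f) ≤ comp e ∧ comp (e * f) ≤ comp f := by
    rw [comp_mul]
    exact ⟨Set.inter_subset_left, Set.inter_subset_right⟩
  have right : comp (f * e) ≤ comp f ∧ comp (f * e) ≤ comp e := by
    rw [comp_mul]
    exact ⟨Set.inter_subset_left, Set.inter_subset_right⟩
  rcases h with h | h | h | h
  · exact Or.inl (by simpa only [h] using left.2)
  · exact Or.inr (by simpa only [h] using left.1)
  · exact Or.inl (by simpa only [h] using right.1)
  · exact Or.inr (by simpa only [h] using right.2)

end Band

section Letters

variable {α : Type*}

/-- The nonempty list of letters of an element of a free semigroup. -/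
def letters (w : FreeSemigroup α) : List α := w.head :: w.tail

theorem length_letters (w : FreeSemigroup α) : (letters w).length = w.length := rfl

theorem exists_letters_eq {w : List α} (hw : w ≠ []) :
    ∃ u : FreeSemigroup α, letters u = w := by
  obtain ⟨x, w, rfl⟩ := List.exists_cons_of_ne_nil hw
  exact ⟨⟨x, w⟩, rfl⟩

end Letters

section UniversalProperty

variable {B : Type*} [Band B]

theorem IG.bar_mul {e f : B} (h : IsBasic e f) : IG.bar e * IG.bar f = IG.bar (e * f) :=
  (Con.eq _).2 (ConGen.Rel.of _ _ (BasicRel.basic e f (isBasic_iff_nonempty.1 h)))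

/-- The morphism from `IG B` induced by a map which respects the products of basic pairs. -/
def IG.lift {N : Type*} [Semigroup N] (f : B → N)
    (hf : ∀ x y, IsBasic x y → f x * f y = f (x * y)) : IG B →ₙ* N where
  toFun a := Con.liftOn a (FreeSemigroup.lift f) fun u v huv => by
    have hle : conGen (BasicRel B) ≤ Con.ker (FreeSemigroup.lift f) := by
      rw [Con.conGen_le]
      rintro _ _ ⟨x, y, hxy⟩
      simpa [Con.ker_apply] using hf x y (isBasic_iff_nonempty.2 hxy)
    exact hle huv
  map_mul' a b := by
    induction a, b using Con.induction_on₂ with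
    | H u v => exact (FreeSemigroup.lift f).map_mul u v

/-- The generator `x̄` in the monoid `IG(B)¹`. -/
def gen (x : B) : WithOne (IG B) := (IG.bar x : WithOne (IG B))

/-- The element of `IG(B)¹` represented by a possibly empty word. -/
def ofList (w : List B) : WithOne (IG B) := (w.map gen).prod

@[simp] theorem ofList_nil : ofList ([] : List B) = 1 := rfl

@[simp] theorem ofList_cons (x : B) (w : List B) : ofList (x :: w) = gen x * ofList w :=
  List.prod_cons

@[simp] theorem ofList_append (u v : List B) : ofList (u ++ v) = ofList u * ofList v := by
  simp [ofList]

theorem ofList_concat (w : List B) (x : B) : ofList (w ++ [x]) = ofList w * gen x := by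
  simp

theorem coe_mk (w : FreeSemigroup B) : (IG.mk w : WithOne (IG B)) = ofList (letters w) := by
  induction w using FreeSemigroup.recOnMul with
  | ih1 x => exact (mul_one (gen x)).symm
  | ih2 x w _ ih => exact congrArg (gen x * ·) ih

theorem exists_ofList_eq (a : WithOne (IG B)) : ∃ w, ofList w = a := by
  rcases eq_or_ne a 1 with rfl | ha
  · exact ⟨[], rfl⟩
  · obtain ⟨b, rfl⟩ := WithOne.ne_one_iff_exists.1 ha
    obtain ⟨w, rfl⟩ : ∃ w, IG.mk w = b := Quotient.exists_rep b
    exact ⟨letters w, (coe_mk w).symm⟩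

theorem prod_map_eq_of_ofList_eq {M : Type*} [Monoid M] {f : B → M}
    (hf : ∀ x y, IsBasic x y → f x * f y = f (x * y)) {u v : List B}
    (h : ofList u = ofList v) : (u.map f).prod = (v.map f).prod := by
  have lift_ofList : ∀ w, WithOne.lift (IG.lift f hf) (ofList w) = (w.map f).prod := fun w => by
    rw [ofList, map_list_prod, List.map_map]
    rfl
  rw [← lift_ofList, h, lift_ofList]

end UniversalProperty

section Weight

variable {B : Type*} [Band B]

/-- A weight on the letters of `B` for which the stack of a word depends only on the element of
`IG(B)¹` it represents. -/
structure IsWeight {N : Type*} [Mul N] (π : B → N) : Prop where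
  map_mul : ∀ {e f : B}, IsBasic e f → comp e = comp f → π (e * f) = π e * π f
  map_mul_of_lt : ∀ {e f : B}, comp e < comp f → π (e * f) = π e
  map_mul_of_gt : ∀ {e f : B}, comp f < comp e → π (e * f) = π f

theorem isWeight_unit : IsWeight fun _ : B => () :=
  ⟨fun _ _ => rfl, fun _ => rfl, fun _ => rfl⟩

namespace IsWeight

variable {N : Type*} [Semigroup N] {π : B → N} (hπ : IsWeight π)

include hπ

theorem mul_self (x : B) : π x * π x = π x := by
  rw [← hπ.map_mul (Or.inl (Band.mul_self x)) rfl, Band.mul_self]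

theorem mul_mul {x y : B} (h : comp x = comp y) : π x * π y * π (y * x) = π x := by
  have hyx : comp (y * x) = comp y := comp_mul_of_le h.ge
  have hy : y * (y * x) = y * x := by rw [← mul_assoc, Band.mul_self]
  have hx : x * (y * x) = x := by rw [← mul_assoc, mul_mul_of_comp_le h.le]
  rw [mul_assoc, ← hπ.map_mul (Or.inr (Or.inl hy)) hyx.symm, hy,
    ← hπ.map_mul (Or.inl hx) (h.trans hyx.symm), hx]

theorem push_push {e f : B} (h : IsBasic e f) (s : List (Set B × N)) :
    push (comp f) (π f) (push (comp e) (π e) s) = push (comp (e * f)) (π (e * f)) s := by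
  rcases h.comp_le_or_le with hle | hle <;> rcases hle.eq_or_lt with heq | hlt
  · rw [comp_mul_of_le heq.le, hπ.map_mul h heq, ← heq, push_push_same]
  · rw [comp_mul_of_le hlt.le, hπ.map_mul_of_lt hlt, push_push_of_lt hlt]
  · rw [comp_mul_of_ge heq.le, hπ.map_mul h heq.symm, heq, push_push_same]
  · rw [comp_mul_of_ge hlt.le, hπ.map_mul_of_gt hlt, push_push_of_gt hlt]

theorem run_eq {u v : List B} (h : ofList u = ofList v) (s : List (Set B × N)) :
    run comp π s u = run comp π s v := by
  let act : B → (Function.End (List (Set B × N)))ᵐᵒᵖ := fun x => .op (push (comp x) (π x))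
  have hact : ∀ x y, IsBasic x y → act x * act y = act (x * y) := fun x y hxy =>
    MulOpposite.unop_injective (funext fun s => hπ.push_push hxy s)
  have act_prod : ∀ (w : List B) s, (w.map act).prod.unop s = run comp π s w := by
    intro w
    induction w with
    | nil => exact fun s => rfl
    | cons x w ih =>
      intro s
      rw [List.map_cons, List.prod_cons, run_cons, ← ih]
      rfl
  rw [← act_prod, ← act_prod, prod_map_eq_of_ofList_eq hact h]

theorem run_concat_eq {p q w : List B} {x : B} (hw : List.IsChain (Adj comp) (x :: w))
    (h : ofList (p ++ x :: w) = ofList (q ++ x :: w)) (s : List (Set B × N)) :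
    run comp π s (p ++ [x]) = run comp π s (q ++ [x]) :=
  run_concat_eq_of_run_append_cons_eq hπ.mul_self (fun _ _ hxy => ⟨_, hπ.mul_mul hxy⟩) hw
    (hπ.run_eq h s)

end IsWeight

end Weight

section Generators

variable {B : Type*} [Band B] {e f a x y : B}

theorem gen_mul (h : IsBasic e f) : gen e * gen f = gen (e * f) := by
  rw [gen, gen, ← WithOne.coe_mul, IG.bar_mul h, gen]

theorem gen_mul_self (x : B) : gen x * gen x = gen x := by
  rw [gen_mul (Or.inl (Band.mul_self x)), Band.mul_self]

theorem IsLocallyLarge.isWeight_gen (hB : IsLocallyLarge B) : IsWeight (gen : B → _) where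
  map_mul h _ := (gen_mul h).symm
  map_mul_of_lt h := by rw [(hB _ _ h).1]
  map_mul_of_gt h := by rw [(hB _ _ h).2]

theorem gen_mul_gen_of_le (h : comp a ≤ comp x) : gen a * gen x = gen a * gen (x * a * x) := by
  have ha : a * (x * a) = a := by rw [← mul_assoc, mul_mul_of_comp_le h]
  have hx : x * (x * a) = x * a := by rw [← mul_assoc, Band.mul_self]
  calc gen a * gen x = gen a * gen (x * a) * gen x := by rw [gen_mul (Or.inl ha), ha]
    _ = gen a * gen (x * a * x) := by rw [mul_assoc, gen_mul (Or.inr (Or.inr (Or.inl hx)))]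

theorem gen_mul_gen_of_ge (h : comp x ≤ comp a) : gen a * gen x = gen (a * x * a) * gen x := by
  have hx : x * a * x = x := mul_mul_of_comp_le h
  have ha : x * a * a = x * a := by rw [mul_assoc, Band.mul_self]
  calc gen a * gen x = gen a * (gen (x * a) * gen x) := by rw [gen_mul (Or.inr (Or.inl hx)), hx]
    _ = gen (a * x * a) * gen x := by
      rw [← mul_assoc, gen_mul (Or.inr (Or.inr (Or.inr ha))), mul_assoc a]

theorem gen_mul_gen_mul_gen (h : comp x = comp y) : gen x * gen y * gen (y * x) = gen x := by
  have hy : y * (y * x) = y * x := by rw [← mul_assoc, Band.mul_self]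
  have hx : x * (y * x) = x := by rw [← mul_assoc, mul_mul_of_comp_le h.le]
  rw [mul_assoc, gen_mul (Or.inr (Or.inl hy)), hy, gen_mul (Or.inl hx), hx]

end Generators

/-! ### Normal forms and cancellation -/

section NormalForm

variable {B : Type*} [Band B] {u v w p q : List B} {a b x z : B}

theorem ofList_concat_mul_gen (h : comp a ≤ comp x) :
    ofList (u ++ [a]) * gen x = ofList (u ++ [a] ++ [x * a * x]) := by
  simp only [ofList_concat, mul_assoc (ofList u), gen_mul_gen_of_le h]

theorem exists_isChain_concat (hu : List.IsChain (Adj comp) u) (x : B) :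
    ∃ v a, List.IsChain (Adj comp) (v ++ [a]) ∧ comp a ≤ comp x ∧
      ofList (v ++ [a]) = ofList u * gen x := by
  induction u using List.reverseRecOn generalizing x with
  | nil => exact ⟨[], x, by simp⟩
  | append_singleton u a ih =>
    have absorb : ∀ {v : List B} {d : B}, List.IsChain (Adj comp) (v ++ [d]) →
        comp d ≤ comp x → ∃ v' a', List.IsChain (Adj comp) (v' ++ [a']) ∧ comp a' ≤ comp x ∧
          ofList (v' ++ [a']) = ofList (v ++ [d]) * gen x := by
      intro v d hv hd
      have hdx : comp (x * d * x) = comp d := comp_sandwich hd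
      refine ⟨v ++ [d], x * d * x, isChain_concat_concat.2 ⟨hv, Or.inl hdx.symm⟩,
        hdx.trans_le hd, ?_⟩
      rw [ofList_concat_mul_gen hd]
    rcases lt_or_eq_or_gt_or_incompRel (comp a) (comp x) with h | h | h | h
    · exact absorb hu h.le
    · exact absorb hu h.le
    · obtain ⟨v, d, hv, hd, hvd⟩ := ih hu.left_of_append (a * x * a)
      rw [comp_sandwich h.le] at hd
      obtain ⟨v', a', hv', ha', hva'⟩ := absorb hv hd
      refine ⟨v', a', hv', ha', ?_⟩
      rw [hva', hvd, ofList_concat, mul_assoc, ← gen_mul_gen_of_ge h.le, ← mul_assoc]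
    · exact ⟨u ++ [a], x, isChain_concat_concat.2 ⟨hu, Or.inr h⟩, le_rfl, ofList_concat _ _⟩

theorem exists_isChain_ofList_eq (w : List B) :
    ∃ u, List.IsChain (Adj comp) u ∧ ofList u = ofList w := by
  induction w using List.reverseRecOn with
  | nil => exact ⟨[], .nil, rfl⟩
  | append_singleton w x ih =>
    obtain ⟨u, hu, huw⟩ := ih
    obtain ⟨v, a, hv, -, hva⟩ := exists_isChain_concat hu x
    exact ⟨v ++ [a], hv, by rw [hva, huw, ofList_concat]⟩

variable (B) in
/-- Two equal products of almost normal forms in `IG(B)¹` which agree from the start `x` of a block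
on, and whose preceding blocks end in the same letter `a`, also agree up to `a`. -/
def CancelsBlocks : Prop :=
  ∀ ⦃u v w : List B⦄ ⦃a x : B⦄, List.IsChain (Adj comp) (u ++ a :: x :: w) →
    List.IsChain (Adj comp) (v ++ a :: x :: w) → IncompRel (· ≤ ·) (comp a) (comp x) →
    ofList (u ++ a :: x :: w) = ofList (v ++ a :: x :: w) → ofList (u ++ [a]) = ofList (v ++ [a])

theorem CancelsBlocks.ofList_eq_of_comp_le (hB : CancelsBlocks B)
    (hu : List.IsChain (Adj comp) (u ++ [z])) (hv : List.IsChain (Adj comp) (v ++ [z]))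
    (hw : List.IsChain (Adj comp) (x :: w)) (hzx : comp z ≤ comp x)
    (h : ofList (u ++ [z]) * ofList w = ofList (v ++ [z]) * ofList w) :
    ofList (u ++ [z]) = ofList (v ++ [z]) := by
  induction w generalizing u v x z with
  | nil => simpa only [ofList_nil, mul_one] using h
  | cons y w ih =>
    rw [List.isChain_cons_cons] at hw
    by_cases hzy : comp z ≤ comp y
    · have ht : comp (y * z * y) = comp z := comp_sandwich hzy
      have undo : ∀ u : List B, ofList (u ++ [z] ++ [y * z * y]) * gen (y * z * y * z) =
          ofList (u ++ [z]) := fun u => by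
        simp only [ofList_concat, mul_assoc (ofList u), gen_mul_gen_mul_gen ht.symm]
      rw [ofList_cons, ← mul_assoc, ← mul_assoc, ofList_concat_mul_gen hzy,
        ofList_concat_mul_gen hzy] at h
      rw [← undo u, ← undo v, ih (isChain_concat_concat.2 ⟨hu, Or.inl ht.symm⟩)
        (isChain_concat_concat.2 ⟨hv, Or.inl ht.symm⟩) hw.2 (ht.trans_le hzy) h]
    · have hinc : IncompRel (· ≤ ·) (comp z) (comp y) := by
        refine ⟨hzy, fun hyz => ?_⟩
        rcases hw.1 with hxy | hxy
        · exact hzy (hzx.trans_eq hxy)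
        · exact hxy.not_ge (hyz.trans hzx)
      have extend : ∀ u : List B, List.IsChain (Adj comp) (u ++ [z]) →
          List.IsChain (Adj comp) (u ++ z :: y :: w) := fun u hu =>
        List.isChain_append_cons_cons.2 ⟨hu, Or.inr hinc, hw.2⟩
      refine hB (extend u hu) (extend v hv) hinc ?_
      simpa [mul_assoc] using h

variable (B) in
/-- Almost normal forms are `𝓡*`-related to their first letter: if `p x w = q x w` in `IG(B)¹`, for
`x w` in almost normal form, then `p x = q x`. -/
def CancelsTails : Prop :=
  ∀ ⦃p q w : List B⦄ ⦃x : B⦄, List.IsChain (Adj comp) (x :: w) →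
    ofList (p ++ x :: w) = ofList (q ++ x :: w) → ofList (p ++ [x]) = ofList (q ++ [x])

theorem IsNormalBand.cancelsTails (hB : IsNormalBand B) (hC : CancelsBlocks B) :
    CancelsTails B := by
  intro p q w x hw h
  have normalForm : ∀ p : List B, ∃ u a, List.IsChain (Adj comp) (u ++ [a]) ∧
      comp a ≤ comp x ∧ ofList (u ++ [a]) = ofList (p ++ [x]) := by
    intro p
    obtain ⟨p', hp', hpp'⟩ := exists_isChain_ofList_eq p
    simpa only [ofList_concat, hpp'] using exists_isChain_concat hp' x
  obtain ⟨u, a, hu, hax, hup⟩ := normalForm p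
  obtain ⟨v, b, hv, hbx, hvq⟩ := normalForm q
  have hab : comp a = comp b := level_eq_of_run_concat_eq hu hv <| by
    rw [isWeight_unit.run_eq hup, isWeight_unit.run_eq hvq, isWeight_unit.run_concat_eq hw h]
  have hz : comp (x * a * x) = comp a := comp_sandwich hax
  have absorb : ∀ {u p : List B} {a : B}, comp a ≤ comp x →
      ofList (u ++ [a]) = ofList (p ++ [x]) →
      ofList (u ++ [a] ++ [x * a * x]) = ofList (p ++ [x]) := by
    intro u p a hax hup
    rw [← ofList_concat_mul_gen hax, hup, ofList_concat, mul_assoc, gen_mul_self]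
  -- In a normal band both normal forms absorb the same element `x a x = x b x`.
  have hup' := absorb hax hup
  have hvq' := absorb hbx hvq
  rw [← hB.sandwich_eq hab] at hvq'
  rw [← hup', ← hvq']
  refine hC.ofList_eq_of_comp_le (isChain_concat_concat.2 ⟨hu, Or.inl hz.symm⟩)
    (isChain_concat_concat.2 ⟨hv, Or.inl (hz.trans hab).symm⟩) hw (hz.trans_le hax) ?_
  rw [hup', hvq', ← ofList_append, ← ofList_append, ← List.append_cons, ← List.append_cons, h]

theorem IsLocallyLarge.stackProd_run (hB : IsLocallyLarge B) (w : List B) :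
    stackProd (run comp gen [] w) = ofList w := by
  obtain ⟨u, hu, huw⟩ := exists_isChain_ofList_eq w
  rw [← hB.isWeight_gen.run_eq huw, FreeIG.stackProd_run hu, ← huw, ofList]

theorem IsLocallyLarge.cancelsTails (hB : IsLocallyLarge B) : CancelsTails B := by
  intro p q w x hw h
  rw [← hB.stackProd_run, ← hB.stackProd_run, hB.isWeight_gen.run_concat_eq hw h]

end NormalForm

section RStar

variable {B : Type*} [Band B]

theorem CancelsTails.rStar_bar_head (hB : CancelsTails B) {w : FreeSemigroup B}
    (hw : List.IsChain (Adj comp) (letters w)) : RStar (IG.mk w) (IG.bar w.head) := by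
  intro a b
  obtain ⟨p, rfl⟩ := exists_ofList_eq a
  obtain ⟨q, rfl⟩ := exists_ofList_eq b
  have hmk : (IG.mk w : WithOne (IG B)) = gen w.head * ofList w.tail := coe_mk w
  constructor <;> intro h
  · have := hB (p := p) (q := q) hw (by simpa only [ofList_append, ofList_cons, hmk] using h)
    rwa [ofList_concat, ofList_concat] at this
  · rw [hmk, ← mul_assoc, ← mul_assoc]
    exact congrArg (· * ofList w.tail) h

end RStar

/-! ### Duality -/

section Duality

open MulOpposite

variable {B : Type*} [Band B]

instance : Band Bᵐᵒᵖ where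
  mul_self x := unop_injective (Band.mul_self x.unop)

theorem comp_le_iff {x y : B} : comp x ≤ comp y ↔ x * y * x = x := by
  refine ⟨mul_mul_of_comp_le, fun h => ?_⟩
  rw [← h, comp_mul, comp_mul]
  exact Set.inter_subset_left.trans Set.inter_subset_right

theorem comp_op_le_iff {x y : B} : comp (op x) ≤ comp (op y) ↔ comp x ≤ comp y := by
  rw [comp_le_iff, comp_le_iff, ← op_mul, ← op_mul, op_inj, mul_assoc]

theorem incompRel_comp_op_iff {x y : B} :
    IncompRel (· ≤ ·) (comp (op x)) (comp (op y)) ↔ IncompRel (· ≤ ·) (comp x) (comp y) := by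
  simp only [IncompRel, comp_op_le_iff]

theorem adj_comp_op_iff {x y : B} : Adj comp (op x) (op y) ↔ Adj comp x y := by
  simp only [Adj, incompRel_comp_op_iff, le_antisymm_iff, comp_op_le_iff]

theorem isChain_reverse_map_op_iff {w : List B} :
    List.IsChain (Adj comp) (w.map op).reverse ↔ List.IsChain (Adj comp) w := by
  rw [List.isChain_reverse, List.isChain_map]
  simp only [adj_comp_op_iff]
  exact ⟨fun h => h.imp fun _ _ => Adj.symm, fun h => h.imp fun _ _ => Adj.symm⟩

theorem ofList_reverse_map_eq {B' : Type*} [Band B'] {f : B → B'}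
    (hf : ∀ x y, f (x * y) = f y * f x) {u v : List B} (h : ofList u = ofList v) :
    ofList (u.map f).reverse = ofList (v.map f).reverse := by
  have basic : ∀ x y, IsBasic x y → op (gen (f x)) * op (gen (f y)) = op (gen (f (x * y))) := by
    intro x y hxy
    have hbasic : IsBasic (f y) (f x) := by
      simp only [IsBasic, ← hf]
      rcases hxy with h | h | h | h <;> simp [h]
    rw [← op_mul, gen_mul hbasic, hf]
  have prod_eq : ∀ w : List B,
      (w.map fun x => op (gen (f x))).prod = op (ofList (w.map f).reverse) := by
    intro w
    rw [ofList, op_list_prod]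
    simp [Function.comp_def]
  rw [← op_inj, ← prod_eq, ← prod_eq, prod_map_eq_of_ofList_eq basic h]

theorem ofList_reverse_map_op_eq_iff {u v : List B} :
    ofList (u.map op).reverse = ofList (v.map op).reverse ↔ ofList u = ofList v := by
  refine ⟨fun h => ?_, ofList_reverse_map_eq op_mul⟩
  simpa [Function.comp_def] using ofList_reverse_map_eq (f := unop) unop_mul h

theorem IsNormalBand.op (hB : IsNormalBand B) : IsNormalBand Bᵐᵒᵖ := by
  intro x y z
  apply unop_injective
  simpa only [unop_mul, mul_assoc] using hB x.unop z.unop y.unop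

theorem IsLocallyLarge.op (hB : IsLocallyLarge B) : IsLocallyLarge Bᵐᵒᵖ := by
  intro u v huv
  have hlt : comp u.unop < comp v.unop := by
    rwa [lt_iff_le_not_ge, ← comp_op_le_iff, ← comp_op_le_iff (x := v.unop)]
  obtain ⟨huv, hvu⟩ := hB _ _ hlt
  exact ⟨unop_injective hvu, unop_injective huv⟩

theorem CancelsTails.lStar_bar_of_letters_eq_concat (hB : CancelsTails Bᵐᵒᵖ)
    {w : FreeSemigroup B} (hw : List.IsChain (Adj comp) (letters w)) {u : List B} {x : B}
    (hux : letters w = u ++ [x]) : LStar (IG.mk w) (IG.bar x) := by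
  intro a b
  obtain ⟨p, rfl⟩ := exists_ofList_eq a
  obtain ⟨q, rfl⟩ := exists_ofList_eq b
  have hmk : (IG.mk w : WithOne (IG B)) = ofList u * gen x := by
    rw [coe_mk, hux, ofList_concat]
  constructor <;> intro h
  · rw [hux, ← isChain_reverse_map_op_iff] at hw
    have heq : ofList (u ++ x :: p) = ofList (u ++ x :: q) := by
      rwa [ofList_append, ofList_append, ofList_cons, ofList_cons, ← mul_assoc, ← mul_assoc, ← hmk]
    have hcancel : ofList ((x :: p).map op).reverse = ofList ((x :: q).map op).reverse := by
      simp only [List.map_cons, List.reverse_cons]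
      refine hB (w := (u.map op).reverse) (by simpa using hw) ?_
      simpa [mul_assoc] using ofList_reverse_map_op_eq_iff.2 heq
    have := ofList_reverse_map_op_eq_iff.1 hcancel
    rwa [ofList_cons, ofList_cons] at this
  · rw [hmk, mul_assoc, mul_assoc]
    exact congrArg (ofList u * ·) h

end Duality

/-! ### Block decompositions and significant indices -/

section BlockDecomposition

variable {Y : Type*} [PartialOrder Y] {a : ℕ → Y} {n r : ℕ} {i j : ℕ → ℕ}

/-- The indices `0 = i 0 < ⋯ < i r = n` cut the positions `1, …, n` into blocks on which the level
`a` is constant, with incomparable levels on neighbouring blocks. -/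
structure IsBlockDecomposition (a : ℕ → Y) (n r : ℕ) (i : ℕ → ℕ) : Prop where
  zero : i 0 = 0
  last : i r = n
  lt : ∀ s < r, i s < i (s + 1)
  level_eq : ∀ s < r, ∀ p, i s < p → p ≤ i (s + 1) → a p = a (i (s + 1))
  incompRel : ∀ s, s + 1 < r → IncompRel (· ≤ ·) (a (i (s + 1))) (a (i (s + 1) + 1))

namespace IsBlockDecomposition

theorem congr (h : IsBlockDecomposition a n r i) (hij : ∀ s ≤ r, i s = j s) :
    IsBlockDecomposition a n r j where
  zero := by rw [← hij 0 r.zero_le, h.zero]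
  last := by rw [← hij r le_rfl, h.last]
  lt s hs := by
    rw [← hij s hs.le, ← hij (s + 1) hs]
    exact h.lt s hs
  level_eq s hs p := by
    rw [← hij s hs.le, ← hij (s + 1) hs]
    exact h.level_eq s hs p
  incompRel s hs := by
    rw [← hij (s + 1) hs.le]
    exact h.incompRel s hs

theorem le_last (h : IsBlockDecomposition a n r i) {s : ℕ} (hs : s ≤ r) : i s ≤ n := by
  rw [← h.last]
  induction hs using Nat.decreasingInduction with
  | self => exact le_rfl
  | of_succ s hs ih => exact (h.lt s hs).le.trans ih

theorem pos (h : IsBlockDecomposition a n r i) {s : ℕ} (hs : 0 < s) (hsr : s ≤ r) : 0 < i s := by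
  obtain ⟨s, rfl⟩ := Nat.exists_eq_add_one.2 hs
  exact (Nat.zero_le _).trans_lt (h.lt s hsr)

theorem exists_block (h : IsBlockDecomposition a n r i) {p : ℕ} (hp : 0 < p) (hpn : p ≤ n) :
    ∃ s < r, i s < p ∧ p ≤ i (s + 1) := by
  have exists_lt : ∀ t ≤ r, p ≤ i t → ∃ s < t, i s < p ∧ p ≤ i (s + 1) := by
    intro t
    induction t with
    | zero => intro _ h0; rw [h.zero] at h0; omega
    | succ t ih =>
      intro ht hpt
      rcases le_or_gt p (i t) with hle | hlt
      · obtain ⟨s, hs, hsp⟩ := ih (by omega) hle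
        exact ⟨s, by omega, hsp⟩
      · exact ⟨t, by omega, hlt, hpt⟩
  exact exists_lt r le_rfl (h.last.symm ▸ hpn)

theorem level_eq_or_exists_eq (h : IsBlockDecomposition a n r i) {p : ℕ} (hp : 0 < p)
    (hpn : p < n) : a p = a (p + 1) ∨ ∃ s, s + 1 < r ∧ i (s + 1) = p := by
  obtain ⟨s, hs, hsp, hps⟩ := h.exists_block hp hpn.le
  rcases hps.lt_or_eq with hlt | rfl
  · exact Or.inl ((h.level_eq s hs p hsp hps).trans (h.level_eq s hs (p + 1) (by omega) hlt).symm)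
  · refine Or.inr ⟨s, lt_of_le_of_ne hs fun hsr => hpn.ne ?_, rfl⟩
    rw [← h.last, ← hsr]

theorem adj (h : IsBlockDecomposition a n r i) {p : ℕ} (hp : 0 < p) (hpn : p < n) :
    Adj a p (p + 1) := by
  rcases h.level_eq_or_exists_eq hp hpn with heq | ⟨s, hs, rfl⟩
  · exact Or.inl heq
  · exact Or.inr (h.incompRel s hs)

theorem isGreatest_block (h : IsBlockDecomposition a n r i) {s : ℕ} (hs : s < r) :
    IsGreatest {p | i s < p ∧ p ≤ n ∧ ∀ q, i s < q → q ≤ p → a p ≤ a q} (i (s + 1)) := by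
  refine ⟨⟨h.lt s hs, h.le_last hs, fun q hsq hqs => (h.level_eq s hs q hsq hqs).ge⟩, ?_⟩
  rintro p ⟨_, hpn, hle⟩
  by_contra! hlt
  have hs' : s + 1 < r := lt_of_le_of_ne hs fun hsr => by
    rw [hsr, h.last] at hlt
    omega
  -- Neighbours are equal or incomparable, so the levels can only bound `a p` if they equal it.
  have level_const : ∀ q, i (s + 1) ≤ q → q ≤ p → a q = a p := by
    intro q hsq hqp
    induction hqp using Nat.decreasingInduction with
    | self => rfl
    | of_succ q hqp ih =>
      have heq := ih (by omega)
      refine Eq.trans ?_ heq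
      have hlt := h.lt s hs
      exact (h.adj (p := q) (by omega) (by omega)).resolve_right fun hinc =>
        hinc.not_ge (heq ▸ hle q (by omega) hqp.le)
  have heq := (level_const _ le_rfl hlt.le).trans (level_const _ (Nat.le_succ _) hlt).symm
  exact (h.incompRel s hs').ne heq

theorem isGreatest_last (h : IsBlockDecomposition a n r i) {s : ℕ} (hs : s < r) :
    IsGreatest {m | i (s + 1) ≤ m ∧ m ≤ n ∧
      ∀ q, i (s + 1) ≤ q → q ≤ m → a (i (s + 1)) ≤ a q} (i (s + 1)) := by
  refine ⟨⟨le_rfl, h.le_last hs, fun q hsq hqs => by rw [le_antisymm hqs hsq]⟩, ?_⟩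
  rintro m ⟨-, hmn, hle⟩
  by_contra! hlt
  have hs' : s + 1 < r := lt_of_le_of_ne hs fun hsr => by
    rw [hsr, h.last] at hlt
    omega
  exact (h.incompRel s hs').not_le (hle _ (Nat.le_succ _) hlt)

end IsBlockDecomposition

theorem exists_isBlockDecomposition (hadj : ∀ p, 0 < p → p < n → Adj a p (p + 1)) :
    ∃ r i, IsBlockDecomposition a n r i := by
  classical
  let IsBlockEnd : ℕ → Prop := fun p => p = 0 ∨ n ≤ p ∨ a p ≠ a (p + 1)
  have infinite : (Set.ofPred IsBlockEnd).Infinite :=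
    (Set.Ici_infinite n).mono fun p hp => Or.inr (Or.inl hp)
  have level_succ : ∀ s p, Nat.nth IsBlockEnd s < p → p < Nat.nth IsBlockEnd (s + 1) →
      a p = a (p + 1) := by
    intro s p hsp hps
    have hp : ¬ IsBlockEnd p := fun hp => (Nat.le_nth_of_lt_nth_succ hps hp).not_gt hsp
    simp only [IsBlockEnd, not_or, not_not] at hp
    exact hp.2.2
  refine ⟨Nat.count IsBlockEnd n, Nat.nth IsBlockEnd, Nat.nth_zero_of_zero (Or.inl rfl),
    Nat.nth_count (Or.inr (Or.inl le_rfl)), fun s _ => Nat.nth_strictMono infinite s.lt_succ_self,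
    fun s _ p hsp hps => ?_, fun s hs => ?_⟩
  · induction hps using Nat.decreasingInduction with
    | self => rfl
    | of_succ q hqs ih => exact (level_succ s q hsp hqs).trans (ih (by omega))
  · have hpos : 0 < Nat.nth IsBlockEnd (s + 1) :=
      (Nat.zero_le _).trans_lt (Nat.nth_strictMono infinite s.lt_succ_self)
    have hlt : Nat.nth IsBlockEnd (s + 1) < n := Nat.nth_lt_of_lt_count hs
    have hend : IsBlockEnd (Nat.nth IsBlockEnd (s + 1)) := Nat.nth_mem_of_infinite infinite _
    exact (hadj _ hpos hlt).resolve_left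
      ((hend.resolve_left hpos.ne').resolve_left hlt.not_ge)

end BlockDecomposition

section Letters

variable {B : Type*} {w : FreeSemigroup B}

theorem getElem?_letters {p : ℕ} (hp : p < w.length) :
    (letters w)[p]? = some (letter w (p + 1)) := by
  have hp' : p < (w.head :: w.tail).length := hp
  simp only [letters, letter, Nat.add_sub_cancel, List.getElem?_eq_getElem hp',
    List.getD_eq_getElem _ _ hp']

theorem letter_length_succ {u v : List B} {x : B} (h : letters w = u ++ x :: v) :
    letter w (u.length + 1) = x := by
  have hlt : u.length < (letters w).length := by simp [h]
  simpa [h] using (getElem?_letters (w := w) hlt).symm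

theorem letter_length_succ_succ {u v : List B} {a x : B} (hw : letters w = u ++ a :: x :: v) :
    letter w (u.length + 1 + 1) = x := by
  rw [List.append_cons] at hw
  simpa using letter_length_succ hw

theorem length_succ_lt_of_letters_eq {u v : List B} {a x : B} (hw : letters w = u ++ a :: x :: v) :
    u.length + 1 < w.length := by
  simp [← length_letters, hw]

theorem letters_subword {p q : ℕ} (hpq : p < q) (hq : q ≤ w.length) :
    letters (subword w (p + 1) q) = ((letters w).drop p).take (q - p) := by
  have hmap : letters (subword w (p + 1) q) = (List.range' (p + 1) (q - p)).map (letter w) := by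
    obtain ⟨m, rfl⟩ := Nat.exists_eq_add_of_lt hpq
    rw [show p + m + 1 - p = m + 1 by omega, List.range'_succ]
    simp [letters, subword, show p + m + 1 - (p + 1) = m by omega]
  rw [hmap]
  refine List.ext_getElem? fun m => ?_
  rw [List.getElem?_map, List.getElem?_take]
  split_ifs with hm
  · rw [List.getElem?_range' hm, List.getElem?_drop, getElem?_letters (by omega)]
    simp [Nat.add_right_comm]
  · simpa using hm

end Letters

section AlmostNormal

variable {B : Type*} [Band B] {w : FreeSemigroup B} {r r' : ℕ} {i j : ℕ → ℕ}

/-- The blocks of the almost normal form `w` end at the positions `i 1 < ⋯ < i r`. -/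
abbrev IsBlockEnds (w : FreeSemigroup B) (r : ℕ) (i : ℕ → ℕ) : Prop :=
  IsBlockDecomposition (fun p => comp (letter w p)) w.length r i

theorem isAlmostNormal_iff : IsAlmostNormal w ↔ ∃ r i, IsBlockEnds w r i := by
  constructor
  · rintro ⟨r, i, α, hzero, hlast, hlt, hα, hinc⟩
    refine ⟨r, i, hzero, hlast, hlt, fun s hs p hsp hps => ?_, fun s hs => ?_⟩
    · rw [hα s hs p hsp hps, hα s hs _ (hlt s hs) le_rfl]
    · rw [hα s (by omega) _ (hlt s (by omega)) le_rfl, hα (s + 1) hs _ (Nat.lt_succ_self _)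
        (hlt (s + 1) hs)]
      exact hinc s hs
  · rintro ⟨r, i, h⟩
    refine ⟨r, i, fun s => comp (letter w (i (s + 1))), h.zero, h.last, h.lt, h.level_eq,
      fun s hs => ?_⟩
    have hinc := h.incompRel s hs
    rwa [h.level_eq (s + 1) hs _ (Nat.lt_succ_self _) (h.lt (s + 1) hs)] at hinc

theorem isAlmostNormal_iff_isChain :
    IsAlmostNormal w ↔ List.IsChain (Adj comp) (letters w) := by
  have letter_succ : ∀ p (hp : p < (letters w).length), (letters w)[p] = letter w (p + 1) :=
    fun p hp => Option.some_inj.1 ((List.getElem?_eq_getElem hp).symm.trans (getElem?_letters hp))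
  rw [isAlmostNormal_iff, List.isChain_iff_getElem]
  constructor
  · rintro ⟨r, i, h⟩ p hp
    rw [letter_succ, letter_succ]
    exact h.adj p.succ_pos hp
  · refine fun h => exists_isBlockDecomposition fun p hp hpn => ?_
    obtain ⟨p, rfl⟩ := Nat.exists_eq_add_one.2 hp
    have hadj := h p hpn
    rw [letter_succ p (Nat.lt_of_succ_lt hpn), letter_succ (p + 1) hpn] at hadj
    exact hadj

theorem IsBlockEnds.isSignificant (h : IsBlockEnds w r i) : IsSignificant w r i :=
  ⟨h.zero, i, h.zero, h.last, fun _ hs => ⟨h.isGreatest_block hs, h.isGreatest_last hs⟩⟩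

theorem IsSignificant.unique (hi : IsSignificant w r i) (hj : IsSignificant w r' j) :
    r = r' ∧ ∀ s ≤ r, i s = j s := by
  obtain ⟨hi, k, hk, hkr, hik⟩ := hi
  obtain ⟨hj, l, hl, hlr, hjl⟩ := hj
  have agree : ∀ s ≤ r, s ≤ r' → k s = l s ∧ i s = j s := by
    intro s
    induction s with
    | zero => exact fun _ _ => ⟨hk.trans hl.symm, hi.trans hj.symm⟩
    | succ s ih =>
      intro hs hs'
      obtain ⟨hi, hk⟩ := hik s hs
      obtain ⟨hj, hl⟩ := hjl s hs'
      have hij : i (s + 1) = j (s + 1) := by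
        rw [(ih (by omega) (by omega)).1] at hi
        exact hi.unique hj
      rw [hij] at hk
      exact ⟨hk.unique hl, hij⟩
  have hrr' : r = r' := by
    rcases lt_trichotomy r r' with h | h | h
    · have hlt := (hjl r h).1.1
      rw [← (agree r le_rfl h.le).1, hkr] at hlt
      exact absurd hlt.2.1 hlt.1.not_ge
    · exact h
    · have hlt := (hik r' h).1.1
      rw [(agree r' h.le le_rfl).1, hlr] at hlt
      exact absurd hlt.2.1 hlt.1.not_ge
  exact ⟨hrr', fun s hs => (agree s hs (hrr' ▸ hs)).2⟩

theorem IsSignificant.isBlockEnds (h : IsSignificant w r i) (hw : IsAlmostNormal w) :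
    IsBlockEnds w r i := by
  obtain ⟨r', j, hj⟩ := isAlmostNormal_iff.1 hw
  obtain ⟨rfl, hji⟩ := hj.isSignificant.unique h
  exact hj.congr hji

namespace IsBlockEnds

theorem isChain (h : IsBlockEnds w r i) : List.IsChain (Adj comp) (letters w) :=
  isAlmostNormal_iff_isChain.1 (isAlmostNormal_iff.2 ⟨r, i, h⟩)

theorem incompRel_getLast_head (h : IsBlockEnds w r i) {s : ℕ} (hs : s ≤ r) :
    ∀ x ∈ ((letters w).take (i s)).getLast?, ∀ y ∈ ((letters w).drop (i s)).head?,
      IncompRel (· ≤ ·) (comp x) (comp y) := by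
  rcases s with _ | s
  · simp [h.zero]
  rcases hs.eq_or_lt with rfl | hlt
  · have hdrop : (letters w).drop (i (s + 1)) = [] := List.drop_of_length_le h.last.ge
    simp [hdrop]
  have hpos : 0 < i (s + 1) := h.pos s.succ_pos hs
  have hend : i (s + 1) < w.length := (h.lt _ hlt).trans_le (h.le_last hlt)
  have hpred : i (s + 1) - 1 < w.length := by omega
  rw [List.getLast?_take, if_neg hpos.ne', getElem?_letters hpred, List.head?_drop,
    getElem?_letters hend, Nat.sub_add_cancel hpos]
  simpa using h.incompRel s hlt

variable {N : Type*} [Mul N] (π : B → N)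

theorem run_take_append_run_drop (h : IsBlockEnds w r i) {s : ℕ} (hs : s ≤ r) :
    run comp π [] ((letters w).drop (i s)) ++ run comp π [] ((letters w).take (i s)) =
      run comp π [] (letters w) := by
  rw [← run_append_of_incompRel π (h.isChain.take _) (h.isChain.drop _)
    (h.incompRel_getLast_head hs), List.take_append_drop]

theorem length_run_take (h : IsBlockEnds w r i) {s : ℕ} (hs : s ≤ r) :
    (run comp π [] ((letters w).take (i s))).length = s := by
  induction s with
  | zero => simp [h.zero]
  | succ s ih =>
    have hlt : i s < i (s + 1) := h.lt s hs
    have hlast : i (s + 1) ≤ w.length := h.le_last hs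
    let block := ((letters w).drop (i s)).take (i (s + 1) - i s)
    have htake : (letters w).take (i (s + 1)) = (letters w).take (i s) ++ block := by
      rw [← List.take_add, Nat.add_sub_cancel' hlt.le]
    have hhead : block.head? = some (letter w (i s + 1)) := by
      rw [List.head?_take, if_neg (by omega), List.head?_drop,
        getElem?_letters (hlt.trans_le hlast)]
    have hlevel : ∀ x ∈ block, comp x = comp (letter w (i (s + 1))) := by
      intro x hx
      obtain ⟨p, hp⟩ := List.mem_iff_getElem?.1 hx
      rw [List.getElem?_take, Option.ite_none_right_eq_some, List.getElem?_drop] at hp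
      obtain ⟨hps, hp⟩ := hp
      rw [getElem?_letters (by omega)] at hp
      exact Option.some_inj.1 hp ▸ h.level_eq s hs _ (by omega) (by omega)
    have hne : block ≠ [] := fun hnil => by simp [hnil] at hhead
    rw [htake, run_append_of_incompRel π (h.isChain.take _) ((h.isChain.drop _).take _) ?_,
      List.length_append, length_run_of_forall_eq π hne hlevel, ih (Nat.le_of_succ_le hs), add_comm]
    intro x hx y hy
    refine h.incompRel_getLast_head (Nat.le_of_succ_le hs) x hx y ?_
    rwa [List.head?_drop, getElem?_letters (hlt.trans_le hlast), ← hhead]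

theorem length_run (h : IsBlockEnds w r i) : (run comp π [] (letters w)).length = r := by
  have hlen := h.length_run_take π le_rfl
  rwa [h.last, List.take_of_length_le (length_letters w).le] at hlen

end IsBlockEnds

end AlmostNormal

/-! ### Condition (P) -/

section ConditionP

open MulOpposite

variable {B : Type*} [Band B] {u v w : FreeSemigroup B} {p : ℕ}

theorem mk_eq_mk_iff : IG.mk u = IG.mk v ↔ ofList (letters u) = ofList (letters v) := by
  rw [← WithOne.coe_inj, coe_mk, coe_mk]

theorem coe_mk_subword_left (hp : 1 ≤ p) (hpn : p ≤ w.length) :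
    (IG.mk (subword w 1 p) : WithOne (IG B)) = ofList ((letters w).take p) := by
  rw [coe_mk, letters_subword hp hpn, List.drop_zero, Nat.sub_zero]

theorem coe_mk_subword_right (hp : p < w.length) :
    (IG.mk (subword w (p + 1) w.length) : WithOne (IG B)) = ofList ((letters w).drop p) := by
  rw [coe_mk, letters_subword hp le_rfl, List.take_of_length_le]
  exact List.length_drop.le

theorem coe_mk_subword_left_of_letters_eq {u v : List B} {a x : B}
    (hw : letters w = u ++ a :: x :: v) :
    (IG.mk (subword w 1 (u.length + 1)) : WithOne (IG B)) = ofList (u ++ [a]) := by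
  rw [coe_mk_subword_left (Nat.le_add_left 1 _) (length_succ_lt_of_letters_eq hw).le, hw,
    List.append_cons, List.take_left' (by simp)]

theorem coe_mk_subword_right_of_letters_eq {u v : List B} {a x : B}
    (hw : letters w = u ++ a :: x :: v) :
    (IG.mk (subword w (u.length + 1 + 1) w.length) : WithOne (IG B)) = ofList (x :: v) := by
  rw [coe_mk_subword_right (length_succ_lt_of_letters_eq hw), hw, List.append_cons,
    List.drop_left' (by simp)]

theorem IsBlockEnds.exists_eq_length_run {r : ℕ} {i : ℕ → ℕ} (h : IsBlockEnds w r i)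
    {u v : List B} {a x : B} (hw : letters w = u ++ a :: x :: v)
    (hax : IncompRel (· ≤ ·) (comp a) (comp x)) :
    ∃ s < r, 1 ≤ s ∧ i s = u.length + 1 ∧
      s = (run comp (fun _ => ()) [] (u ++ [a])).length := by
  have hlevel : comp (letter w (u.length + 1)) ≠ comp (letter w (u.length + 1 + 1)) := by
    rw [letter_length_succ hw, letter_length_succ_succ hw]
    exact hax.ne
  obtain ⟨s, hs, his⟩ := (h.level_eq_or_exists_eq (Nat.succ_pos _)
    (length_succ_lt_of_letters_eq hw)).resolve_left hlevel
  refine ⟨s + 1, hs, Nat.le_add_left 1 s, his, ?_⟩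
  have hlen := h.length_run_take (fun _ => ()) hs.le
  rw [his, hw, List.append_cons, List.take_left' (by simp)] at hlen
  exact hlen.symm

theorem ConditionP.ofList_eq_of_length_run_eq (hP : ConditionP B) {u v w z : List B}
    {a b x y : B} (hu : List.IsChain (Adj comp) (u ++ a :: x :: w))
    (hv : List.IsChain (Adj comp) (v ++ b :: y :: z))
    (hax : IncompRel (· ≤ ·) (comp a) (comp x)) (hby : IncompRel (· ≤ ·) (comp b) (comp y))
    (h : ofList (u ++ a :: x :: w) = ofList (v ++ b :: y :: z))
    (hlen : (run comp (fun _ => ()) [] (u ++ [a])).length =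
      (run comp (fun _ => ()) [] (v ++ [b])).length) :
    (GreenL a b → ofList (u ++ [a]) = ofList (v ++ [b])) ∧
      (GreenR x y → ofList (x :: w) = ofList (y :: z)) := by
  obtain ⟨U, hU⟩ := exists_letters_eq (w := u ++ a :: x :: w) (by simp)
  obtain ⟨V, hV⟩ := exists_letters_eq (w := v ++ b :: y :: z) (by simp)
  rw [← hU, ← isAlmostNormal_iff_isChain] at hu
  rw [← hV, ← isAlmostNormal_iff_isChain] at hv
  rw [← hU, ← hV] at h
  obtain ⟨r, i, hi⟩ := isAlmostNormal_iff.1 hu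
  obtain ⟨r', j, hj⟩ := isAlmostNormal_iff.1 hv
  obtain rfl : r = r' := by
    rw [← hi.length_run fun _ => (), isWeight_unit.run_eq h, hj.length_run]
  obtain ⟨s, hs, hpos, his, hsu⟩ := hi.exists_eq_length_run hU hax
  obtain ⟨t, -, -, hjt, htv⟩ := hj.exists_eq_length_run hV hby
  obtain rfl : s = t := hsu.trans (hlen.trans htv.symm)
  obtain ⟨hleft, hright⟩ :=
    hP U V hu hv (mk_eq_mk_iff.2 h) r i j hi.isSignificant hj.isSignificant
  have hleft := hleft s hpos hs.le
  have hright := hright s hs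
  rw [his, hjt, ← WithOne.coe_inj] at hleft hright
  rw [letter_length_succ hU, letter_length_succ hV, coe_mk_subword_left_of_letters_eq hU,
    coe_mk_subword_left_of_letters_eq hV] at hleft
  rw [letter_length_succ_succ hU, letter_length_succ_succ hV,
    coe_mk_subword_right_of_letters_eq hU, coe_mk_subword_right_of_letters_eq hV] at hright
  exact ⟨hleft, hright⟩

theorem ConditionP.cancelsBlocks (hP : ConditionP B) : CancelsBlocks B := by
  intro u v w a x hu hv hax h
  have run_split : ∀ {u : List B}, List.IsChain (Adj comp) (u ++ a :: x :: w) →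
      run comp (fun _ => ()) [] (u ++ a :: x :: w) =
        run comp (fun _ => ()) [] (x :: w) ++ run comp (fun _ => ()) [] (u ++ [a]) := by
    intro u hu
    rw [List.append_cons] at hu ⊢
    exact run_append_of_incompRel _ hu.left_of_append hu.right_of_append (by simpa using hax)
  have hrun := isWeight_unit.run_eq h []
  rw [run_split hu, run_split hv] at hrun
  exact (hP.ofList_eq_of_length_run_eq hu hv hax hax h
    (congrArg List.length (List.append_cancel_left hrun))).1 rfl

theorem ConditionP.cancelsBlocks_op (hP : ConditionP B) : CancelsBlocks Bᵐᵒᵖ := by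
  have exists_reverse_map_op : ∀ u : List Bᵐᵒᵖ, ∃ u' : List B, (u'.map op).reverse = u :=
    fun u => ⟨(u.map unop).reverse, by simp [Function.comp_def]⟩
  intro u v w a x hu hv hax h
  obtain ⟨u, rfl⟩ := exists_reverse_map_op u
  obtain ⟨v, rfl⟩ := exists_reverse_map_op v
  obtain ⟨w, rfl⟩ := exists_reverse_map_op w
  obtain ⟨a, rfl⟩ := op_surjective a
  obtain ⟨x, rfl⟩ := op_surjective x
  have reverse_split : ∀ u : List B, (u.map op).reverse ++ op a :: op x :: (w.map op).reverse =
      ((w ++ x :: a :: u).map op).reverse := fun u => by simp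
  rw [reverse_split, isChain_reverse_map_op_iff] at hu hv
  rw [reverse_split, reverse_split, ofList_reverse_map_op_eq_iff] at h
  rw [incompRel_comp_op_iff] at hax
  have hcons : ofList (a :: u) = ofList (a :: v) :=
    (hP.ofList_eq_of_length_run_eq hu hv hax.symm hax.symm h rfl).2 rfl
  simpa using ofList_reverse_map_op_eq_iff.2 hcons

theorem IsLocallyLarge.conditionP (hB : IsLocallyLarge B) : ConditionP B := by
  intro u v hu hv huv r i l hi hl
  have hi := hi.isBlockEnds hu
  have hl := hl.isBlockEnds hv
  have hrun := hB.isWeight_gen.run_eq (mk_eq_mk_iff.1 huv) []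
  have split : ∀ s ≤ r, ofList ((letters u).take (i s)) = ofList ((letters v).take (l s)) ∧
      ofList ((letters u).drop (i s)) = ofList ((letters v).drop (l s)) := by
    intro s hs
    rw [← hi.run_take_append_run_drop gen hs, ← hl.run_take_append_run_drop gen hs] at hrun
    have hlen := (hi.length_run_take gen hs).trans (hl.length_run_take gen hs).symm
    obtain ⟨hdrop, htake⟩ := List.append_inj' hrun hlen
    simp only [← hB.stackProd_run, hdrop, htake, and_self]
  refine ⟨fun s hpos hs _ => ?_, fun t ht _ => ?_⟩
  · rw [← WithOne.coe_inj, coe_mk_subword_left (hi.pos hpos hs) (hi.le_last hs),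
      coe_mk_subword_left (hl.pos hpos hs) (hl.le_last hs), (split s hs).1]
  · rw [← WithOne.coe_inj, coe_mk_subword_right ((hi.lt t ht).trans_le (hi.le_last ht)),
      coe_mk_subword_right ((hl.lt t ht).trans_le (hl.le_last ht)), (split t ht.le).2]

end ConditionP

section Abundance

variable {B : Type*} [Band B]

theorem isIdempotentElem_bar (x : B) : IsIdempotentElem (IG.bar x) := by
  rw [IsIdempotentElem, IG.bar_mul (Or.inl (Band.mul_self x)), Band.mul_self]

theorem CancelsTails.rStar_bar (hB : CancelsTails B) {w : FreeSemigroup B}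
    (hw : IsAlmostNormal w) : RStar (IG.mk w) (IG.bar (letter w 1)) :=
  hB.rStar_bar_head (isAlmostNormal_iff_isChain.1 hw)

theorem CancelsTails.lStar_bar (hB : CancelsTails Bᵐᵒᵖ) {w : FreeSemigroup B}
    (hw : IsAlmostNormal w) : LStar (IG.mk w) (IG.bar (letter w w.length)) := by
  obtain ⟨u, x, hux⟩ := (List.eq_nil_or_concat' (letters w)).resolve_left (List.cons_ne_nil _ _)
  have hlast : letter w w.length = x := by
    rw [← length_letters, hux, List.length_append]
    exact letter_length_succ hux
  rw [hlast]
  exact hB.lStar_bar_of_letters_eq_concat (isAlmostNormal_iff_isChain.1 hw) hux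

theorem exists_isAlmostNormal_mk_eq (a : IG B) : ∃ w, IsAlmostNormal w ∧ IG.mk w = a := by
  obtain ⟨w, rfl⟩ : ∃ w, IG.mk w = a := Quotient.exists_rep a
  obtain ⟨u, hu, huw⟩ := exists_isChain_ofList_eq (letters w)
  rw [← coe_mk] at huw
  have hne : u ≠ [] := by
    rintro rfl
    exact WithOne.one_ne_coe huw
  obtain ⟨u, rfl⟩ := exists_letters_eq hne
  exact ⟨u, isAlmostNormal_iff_isChain.2 hu, WithOne.coe_injective ((coe_mk u).trans huw)⟩

theorem isAbundant_of_cancelsTails (hB : CancelsTails B) (hB' : CancelsTails Bᵐᵒᵖ) :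
    IsAbundant (IG B) := by
  intro a
  obtain ⟨w, hw, rfl⟩ := exists_isAlmostNormal_mk_eq a
  exact ⟨⟨_, isIdempotentElem_bar _, hB'.lStar_bar hw⟩,
    ⟨_, isIdempotentElem_bar _, hB.rStar_bar hw⟩⟩

end Abundance

end FreeIG

theorem mainTheorem2 {B : Type*} [Band B] :
    (ConditionP B → IsNormalBand B ∨ IsLocallyLarge B →
      IsAbundant (IG B) ∧
      ∀ w : FreeSemigroup B, IsAlmostNormal w →
        RStar (IG.mk w) (IG.bar (letter w 1)) ∧ LStar (IG.mk w) (IG.bar (letter w w.length))) ∧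
    (IsLocallyLarge B → ConditionP B) ∧
    (IsLocallyLarge B → IsAbundant (IG B)) := by
  have cancelsTails : ConditionP B → IsNormalBand B ∨ IsLocallyLarge B →
      CancelsTails B ∧ CancelsTails Bᵐᵒᵖ := by
    rintro hP (hB | hB)
    · exact ⟨hB.cancelsTails hP.cancelsBlocks, hB.op.cancelsTails hP.cancelsBlocks_op⟩
    · exact ⟨hB.cancelsTails, hB.op.cancelsTails⟩
  refine ⟨fun hP hB => ?_, fun hB => hB.conditionP, fun hB =>
    isAbundant_of_cancelsTails hB.cancelsTails hB.op.cancelsTails⟩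
  obtain ⟨hR, hL⟩ := cancelsTails hP hB
  exact ⟨isAbundant_of_cancelsTails hR hL, fun w hw => ⟨hR.rStar_bar hw, hL.lStar_bar hw⟩⟩
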